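/- Let $d,n\in\mathbb N$, let $M_n(\mathbb C)$ be the algebra of complex $n\times n$ matrices, let $S^1=\{z\in\mathbb C: |z|=1\}$, and let $W$ be the bilateral shift on $\ell^2(\mathbb Z)$, i.e. the unitary with $We_i=e_{i+1}$ for the canonical orthonormal basis $(e_i)_{i\in\mathbb Z}$. For a $d$-tuple $T=(T_1,\dots,T_d)$ of bounded linear operators on a complex Hilbert space $H$: * the matrix range of $T$ is the graded set $\mathbb W(T)=\bigcup_{m\in\mathbb N}W_m(T)$, where $W_m(T)$ is the set of all $(\varphi(T_1),\dots,\varphi(T_d))\in M_m(\mathbb C)^d$ with $\varphi:B(H)\to M_m(\mathbb C)$ a unital completely positive linear map; * $T$ is Toeplitz-contractive if the $(d+1)\times(d+1)$ operator matrix $\mathcal T=(\mathcal T_{ij})_{i,j=0}^{d}$ with $\mathcal T_{ij}=T_{i-j}$ for $i>j$, $\mathcal T_{ii}=1_H$ and $\mathcal T_{ij}=T_{j-i}^*$ for $i<j$ is a positive operator on the direct sum of $d+1$ copies of $H$. Then the following statements are equivalent for every $A=(A_1,\dots,A_d)\in M_n(\mathbb C)^d$ (matrices being regarded as operators on the Hilbert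 space $\mathbb C^n$): 1. $A\in\mathbb W(W,W^2,\dots,W^d)$; 2. $A$ is Toeplitz-contractive; 3. there exist $\ell\in\mathbb N$, $\lambda_1,\dots,\lambda_\ell\in S^1$ and positive semidefinite $Q_1,\dots,Q_\ell\in M_n(\mathbb C)$ such that $\sum_{j=1}^{\ell}Q_j=1_n$ and $A_k=\sum_{j=1}^{\ell}\lambda_j^kQ_j$ for all $k=1,\dots,d$. -/

import Mathlib

open scoped CStarAlgebra ComplexOrder

section Definitions

variable {H : Type*} [NormedAddCommGroup H] [InnerProductSpace ℂ H]

/-- The operator on the Hilbert space direct sum of `m` copies of `H` given by an `m × m`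
matrix of operators on `H`. -/
noncomputable def blockOperator {m : ℕ} (M : Matrix (Fin m) (Fin m) (H →L[ℂ] H)) :
    PiLp 2 (fun _ : Fin m => H) →L[ℂ] PiLp 2 (fun _ : Fin m => H) :=
  ((PiLp.continuousLinearEquiv 2 ℂ (fun _ : Fin m => H)).symm :
      (Fin m → H) →L[ℂ] PiLp 2 (fun _ : Fin m => H)) ∘L
    ContinuousLinearMap.pi fun i => ∑ j, M i j ∘L PiLp.proj 2 (fun _ : Fin m => H) j

theorem blockOperator_apply {m : ℕ} (M : Matrix (Fin m) (Fin m) (H →L[ℂ] H))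
    (x : PiLp 2 (fun _ : Fin m => H)) (i : Fin m) :
    blockOperator M x i = ∑ j, M i j (x j) := by
  simp [blockOperator]

variable [CompleteSpace H]

/-- The Toeplitz operator matrix of `(T₁, …, T_d)`, where `T_k` is `T ⟨k - 1, _⟩`: the entry at
`(i, j)` is `T_{i-j}` below the diagonal, the identity on the diagonal, and `T_{j-i}^*` above. -/
noncomputable def toeplitzMatrix {d : ℕ} (T : Fin d → H →L[ℂ] H) :
    Matrix (Fin (d + 1)) (Fin (d + 1)) (H →L[ℂ] H) := fun i j =>
  if h : j < i then T ⟨i - j - 1, by omega⟩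
  else if h : i < j then ContinuousLinearMap.adjoint (T ⟨j - i - 1, by omega⟩)
  else 1

/-- A tuple of operators is Toeplitz-contractive if its Toeplitz operator matrix is a positive
operator on the direct sum of `d + 1` copies of the Hilbert space. -/
def ToeplitzContractive {d : ℕ} (T : Fin d → H →L[ℂ] H) : Prop :=
  (blockOperator (toeplitzMatrix T)).IsPositive

/-- The `n`-th matrix range `W_n(T)`: all `(φ(T₁), …, φ(T_d))` for unital completely positive
`φ : B(H) → M_n(ℂ)`. Here `CStarMatrix (Fin n) (Fin n) ℂ` is the C⋆-algebra `M_n(ℂ)`. -/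
def nthMatrixRange {d : ℕ} (T : Fin d → H →L[ℂ] H) (n : ℕ) :
    Set (Fin d → Matrix (Fin n) (Fin n) ℂ) :=
  {A | ∃ φ : (H →L[ℂ] H) →CP CStarMatrix (Fin n) (Fin n) ℂ,
    φ 1 = 1 ∧ ∀ k, φ (T k) = CStarMatrix.ofMatrix (A k)}

/-- The matrix range of `T`: the graded set formed by all the `n`-th matrix ranges. -/
def matrixRange {d : ℕ} (T : Fin d → H →L[ℂ] H) :
    Set (Σ n : ℕ, Fin d → Matrix (Fin n) (Fin n) ℂ) :=
  {A | A.2 ∈ nthMatrixRange T A.1}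

end Definitions

/-- The Hilbert space `ℓ²(ℤ)`. -/
abbrev EllTwoInt : Type := lp (fun _ : ℤ => ℂ) 2

/-- The bilateral shift on `ℓ²(ℤ)`, `(W f)(i) = f (i - 1)`, as a linear isometry. -/
noncomputable def bilateralShiftIsometry : EllTwoInt →ₗᵢ[ℂ] EllTwoInt where
  toFun f := ⟨fun i => f (i - 1), by
    have h2 : 0 < (2 : ENNReal).toReal := by norm_num
    have hf := (memℓp_gen_iff h2).1 (lp.memℓp f)
    refine (memℓp_gen_iff (E := fun _ : ℤ => ℂ) (f := fun i => f (i - 1)) h2).2 ?_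
    exact hf.comp_injective (sub_left_injective (b := (1 : ℤ)))⟩
  map_add' f g := by ext i; rfl
  map_smul' c f := by ext i; rfl
  norm_map' f := by
    have h2 : 0 < (2 : ENNReal).toReal := by norm_num
    rw [lp.norm_eq_tsum_rpow h2, lp.norm_eq_tsum_rpow h2]
    congr 1
    exact (Equiv.subRight (1 : ℤ)).tsum_eq (fun i => ‖f i‖ ^ (2 : ENNReal).toReal)

/-- The bilateral shift operator `W` on `ℓ²(ℤ)`. -/
noncomputable def bilateralShift : EllTwoInt →L[ℂ] EllTwoInt :=
  bilateralShiftIsometry.toContinuousLinearMap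

theorem bilateralShift_apply (f : EllTwoInt) (i : ℤ) : bilateralShift f i = f (i - 1) := rfl

/-- `(W, W², …, W^d)`. -/
noncomputable def shiftPowers (d : ℕ) : Fin d → EllTwoInt →L[ℂ] EllTwoInt :=
  fun k => bilateralShift ^ (k.val + 1)

/-! The conditions are proved in a cycle. From 1 to 2: the operator matrix with entries `W^i
(W^j)^*` is positive, and it is the Toeplitz matrix of the shift powers because `W` is unitary; a
unital completely positive map carries it to the Toeplitz matrix of `A`.

From 2 to 3: factor the Toeplitz matrix as a Gram matrix of maps `F i`. Constancy along diagonals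
makes `F i ↦ F (i + 1)` isometric, so it extends to a unitary on a finite-dimensional space
(`ToeplitzContractive.exists_dilation`). An orthonormal eigenbasis then gives finitely many points
of the circle, with rank-one weights.

From 3 to 1: every point of the circle is an approximate eigenvalue of `W`, hence yields a state
with `W^k ↦ λ^k`; weighting these states by the `Q j` gives the required map. -/

/-! ### Spectral theorem for isometries in finite dimension -/

section Diagonalization

open Module End

variable {V : Type*} [NormedAddCommGroup V] [InnerProductSpace ℂ V]

theorem LinearIsometry.norm_eq_one_of_map_eq_smul (U : V →ₗᵢ[ℂ] V) {c : ℂ} {v : V}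
    (hv : U v = c • v) (h0 : v ≠ 0) : ‖c‖ = 1 := by
  have h := U.norm_map v
  rw [hv, norm_smul] at h
  exact mul_right_cancel₀ (norm_ne_zero_iff.2 h0) (by rw [h, one_mul])

theorem LinearIsometry.orthogonalFamily_eigenspaces (U : V →ₗᵢ[ℂ] V) :
    OrthogonalFamily ℂ (fun c => eigenspace U.toLinearMap c)
      fun c => (eigenspace U.toLinearMap c).subtypeₗᵢ := by
  rintro c c' hcc ⟨v, hv⟩ ⟨w, hw⟩
  rw [mem_eigenspace_iff] at hv hw
  change U v = c • v at hv
  change U w = c' • w at hw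
  change inner ℂ v w = 0
  by_cases h0 : v = 0
  · simp [h0]
  have hc := U.norm_eq_one_of_map_eq_smul hv h0
  have h := U.inner_map_map v w
  rw [hv, hw, inner_smul_left, inner_smul_right] at h
  have hcc' : c * (starRingEnd ℂ) c = 1 := by
    rw [Complex.mul_conj, Complex.normSq_eq_norm_sq, hc]; simp
  have h' : (c' - c) * inner ℂ v w = 0 := by linear_combination c * h - c' * inner ℂ v w * hcc'
  rcases mul_eq_zero.1 h' with h' | h'
  · exact absurd (sub_eq_zero.1 h').symm hcc
  · exact h'

theorem LinearIsometry.iSup_eigenspace_orthogonal_eq_bot [FiniteDimensional ℂ V]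
    (U : V →ₗᵢ[ℂ] V) : (⨆ c, eigenspace U.toLinearMap c)ᗮ = ⊥ := by
  set S := ⨆ c, eigenspace U.toLinearMap c with hS
  -- If `U w = c • w` and `v ⟂ w`, then `conj c * ⟪w, U v⟫ = ⟪U w, U v⟫ = 0` with `c ≠ 0`. A nonzero
  -- complement would thus contain an eigenvector.
  have hinv : ∀ v ∈ Sᗮ, U.toLinearMap v ∈ Sᗮ := by
    intro v hv
    rw [hS, ← Submodule.iInf_orthogonal, Submodule.mem_iInf] at hv ⊢
    intro c w hw
    have h1 : inner ℂ w v = 0 := hv c w hw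
    rw [mem_eigenspace_iff] at hw
    change U w = c • w at hw
    change inner ℂ w (U v) = 0
    by_cases h0 : w = 0
    · simp [h0]
    have hc := U.norm_eq_one_of_map_eq_smul hw h0
    have h := U.inner_map_map w v
    rw [hw, inner_smul_left, h1] at h
    refine (mul_eq_zero.1 h).resolve_left fun hc0 => ?_
    rw [map_eq_zero] at hc0
    simp [hc0] at hc
  by_contra hne
  have : Nontrivial Sᗮ := Submodule.nontrivial_iff_ne_bot.2 hne
  obtain ⟨c, hc⟩ := Module.End.exists_eigenvalue (U.toLinearMap.restrict hinv)
  obtain ⟨v, hv⟩ := hc.exists_hasEigenvector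
  have hv1 := congrArg Subtype.val hv.apply_eq_smul
  have hvS : (v : V) ∈ S :=
    Submodule.mem_iSup_of_mem c (mem_eigenspace_iff.2 hv1)
  have h0 : inner ℂ (v : V) (v : V) = 0 := v.2 _ hvS
  exact hv.2 (Subtype.ext (inner_self_eq_zero.1 h0))

theorem LinearIsometry.exists_orthonormalBasis_eigenvectors [FiniteDimensional ℂ V]
    (U : V →ₗᵢ[ℂ] V) :
    ∃ (b : OrthonormalBasis (Fin (finrank ℂ V)) ℂ V) (c : Fin (finrank ℂ V) → Circle),
      ∀ j, U (b j) = (c j : ℂ) • b j := by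
  classical
  have ho : OrthogonalFamily ℂ (fun c : Eigenvalues U.toLinearMap => eigenspace U.toLinearMap c)
      fun c => (eigenspace U.toLinearMap c).subtypeₗᵢ :=
    U.orthogonalFamily_eigenspaces.comp Subtype.coe_injective
  have hi : DirectSum.IsInternal
      (fun c : Eigenvalues U.toLinearMap => eigenspace U.toLinearMap (c : ℂ)) := by
    rw [ho.isInternal_iff]
    change (⨆ c : { c : ℂ // (eigenspace U.toLinearMap c) ≠ ⊥ },
      eigenspace U.toLinearMap (c : ℂ))ᗮ = ⊥
    rw [iSup_ne_bot_subtype, U.iSup_eigenspace_orthogonal_eq_bot]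
  let b := hi.subordinateOrthonormalBasis rfl ho
  have hb : ∀ j, ∃ c : ℂ, U (b j) = c • b j := fun j =>
    ⟨_, mem_eigenspace_iff.1 (hi.subordinateOrthonormalBasis_subordinate rfl j ho)⟩
  choose c hc using hb
  have hc1 : ∀ j, c j ∈ Submonoid.unitSphere ℂ := fun j => by
    refine mem_sphere_zero_iff_norm.2 ?_
    exact U.norm_eq_one_of_map_eq_smul (hc j) (b.orthonormal.ne_zero j)
  exact ⟨b, fun j => ⟨c j, hc1 j⟩, hc⟩

/-- Two linear maps into a finite-dimensional inner product space with the same pointwise norms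
differ by an isometry of the codomain. -/
theorem LinearMap.exists_linearIsometry_comp_eq [FiniteDimensional ℂ V] {E : Type*}
    [AddCommGroup E] [Module ℂ E] (F G : E →ₗ[ℂ] V) (h : ∀ x, ‖F x‖ = ‖G x‖) :
    ∃ U : V →ₗᵢ[ℂ] V, ∀ x, U (F x) = G x := by
  have hker : LinearMap.ker F ≤ LinearMap.ker G := fun x hx => by
    rw [LinearMap.mem_ker] at hx ⊢
    rw [← norm_eq_zero, ← h, hx, norm_zero]
  let g : LinearMap.range F →ₗ[ℂ] V :=
    (LinearMap.ker F).liftQ G hker ∘ₗ F.quotKerEquivRange.symm.toLinearMap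
  have hg : ∀ x, g ⟨F x, LinearMap.mem_range_self F x⟩ = G x := fun x => by
    have : F.quotKerEquivRange.symm ⟨F x, LinearMap.mem_range_self F x⟩ =
        (LinearMap.ker F).mkQ x := F.quotKerEquivRange_symm_apply_image x _
    simp [g, this]
  let L : LinearMap.range F →ₗᵢ[ℂ] V :=
    { g with
      norm_map' := by
        rintro ⟨_, x, rfl⟩
        change ‖g ⟨F x, _⟩‖ = ‖F x‖
        rw [hg, h] }
  -- Finite dimension is essential: the complements of the two ranges have equal dimension.
  refine ⟨L.extend, fun x => ?_⟩
  rw [← hg x]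
  exact L.extend_apply ⟨F x, LinearMap.mem_range_self F x⟩

end Diagonalization

/-! ### Dilation of Toeplitz-contractive tuples -/

section Toeplitz

variable {H : Type*} [NormedAddCommGroup H] [InnerProductSpace ℂ H]

theorem inner_blockOperator {m : ℕ} (M : Matrix (Fin m) (Fin m) (H →L[ℂ] H))
    (x y : PiLp 2 (fun _ : Fin m => H)) :
    inner ℂ (blockOperator M x) y = ∑ i, ∑ j, inner ℂ (M i j (x j)) (y i) := by
  simp [PiLp.inner_apply, blockOperator_apply, sum_inner]

theorem inner_single_blockOperator_single {m : ℕ} (M : Matrix (Fin m) (Fin m) (H →L[ℂ] H))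
    (i j : Fin m) (x y : H) :
    inner ℂ (PiLp.single 2 (β := fun _ : Fin m => H) i x)
      (blockOperator M (PiLp.single 2 j y)) = inner ℂ x (M i j y) := by
  rw [PiLp.inner_apply, Finset.sum_eq_single i]
  · rw [blockOperator_apply, Finset.sum_eq_single j]
    · simp
    · intro k _ hk; simp [hk]
    · simp
  · intro k _ hk; simp [hk]
  · simp

variable [CompleteSpace H] {d : ℕ}

theorem toeplitzMatrix_succ_zero (T : Fin d → H →L[ℂ] H) (k : Fin d) :
    toeplitzMatrix T k.succ 0 = T k := by
  simp [toeplitzMatrix]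

theorem toeplitzMatrix_self (T : Fin d → H →L[ℂ] H) (i : Fin (d + 1)) :
    toeplitzMatrix T i i = 1 := by
  simp [toeplitzMatrix]

theorem toeplitzMatrix_succ_succ (T : Fin d → H →L[ℂ] H) (i j : Fin d) :
    toeplitzMatrix T i.succ j.succ = toeplitzMatrix T i.castSucc j.castSucc := by
  simp [toeplitzMatrix]

theorem ContinuousLinearMap.IsPositive.exists_inner_apply_eq {T : H →L[ℂ] H}
    (hT : T.IsPositive) : ∃ S : H →L[ℂ] H, ∀ x y, inner ℂ (S x) (S y) = inner ℂ x (T y) := by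
  rw [← ContinuousLinearMap.nonneg_iff_isPositive] at hT
  obtain ⟨S, rfl⟩ := CStarAlgebra.nonneg_iff_eq_star_mul_self.1 hT
  exact ⟨S, fun x y => (ContinuousLinearMap.adjoint_inner_right S _ _).symm⟩

theorem exists_gram_of_blockOperator_isPositive {m : ℕ}
    {M : Matrix (Fin m) (Fin m) (H →L[ℂ] H)} (hM : (blockOperator M).IsPositive) :
    ∃ F : Fin m → H →ₗ[ℂ] PiLp 2 (fun _ : Fin m => H),
      ∀ i j x y, inner ℂ (F i x) (F j y) = inner ℂ x (M i j y) := by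
  obtain ⟨S, hS⟩ := hM.exists_inner_apply_eq
  refine ⟨fun i => S.toLinearMap ∘ₗ (WithLp.linearEquiv 2 ℂ (Fin m → H)).symm.toLinearMap ∘ₗ
    LinearMap.single ℂ (fun _ => H) i, fun i j x y => ?_⟩
  rw [← inner_single_blockOperator_single M i j x y]
  exact hS _ _

/-- A Toeplitz-contractive tuple on a finite-dimensional space dilates to the powers of the
adjoint of a unitary on a finite-dimensional space. -/
theorem ToeplitzContractive.exists_dilation [FiniteDimensional ℂ H] {T : Fin d → H →L[ℂ] H}
    (hT : ToeplitzContractive T) :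
    ∃ (U : PiLp 2 (fun _ : Fin (d + 1) => H) →ₗᵢ[ℂ] PiLp 2 (fun _ : Fin (d + 1) => H))
      (F : H →ₗ[ℂ] PiLp 2 (fun _ : Fin (d + 1) => H)),
      (∀ x y, inner ℂ (F x) (F y) = inner ℂ x y) ∧
      ∀ k x y, inner ℂ (U^[k.val + 1] (F x)) (F y) = inner ℂ x (T k y) := by
  obtain ⟨F, hF⟩ := exists_gram_of_blockOperator_isPositive hT
  -- Dropping the last or the first row and column of a Toeplitz matrix leaves the same matrix, so
  -- `G₁` and `G₂` have equal Gram forms.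
  let G₁ := LinearMap.lsum ℂ (fun _ : Fin d => H) ℂ fun j => F j.castSucc
  let G₂ := LinearMap.lsum ℂ (fun _ : Fin d => H) ℂ fun j => F j.succ
  have hG : ∀ x, ‖G₁ x‖ = ‖G₂ x‖ := fun x => by
    have : inner ℂ (G₁ x) (G₁ x) = inner ℂ (G₂ x) (G₂ x) := by
      simp only [G₁, G₂, LinearMap.lsum_apply, LinearMap.sum_apply, LinearMap.comp_apply,
        LinearMap.proj_apply, sum_inner, inner_sum, hF, toeplitzMatrix_succ_succ]
    rw [norm_eq_sqrt_re_inner (𝕜 := ℂ), norm_eq_sqrt_re_inner (𝕜 := ℂ), this]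
  obtain ⟨U, hU⟩ := G₁.exists_linearIsometry_comp_eq G₂ hG
  have hUF : ∀ (j : Fin d) x, U (F j.castSucc x) = F j.succ x := fun j x => by
    have := hU (Pi.single j x)
    rwa [LinearMap.lsum_piSingle, LinearMap.lsum_piSingle] at this
  have hpow : ∀ (j : Fin (d + 1)) x, U^[j.val] (F 0 x) = F j x := fun j x => by
    induction j using Fin.induction with
    | zero => rfl
    | succ j ih => rw [← hUF, ← ih, Fin.val_succ, Function.iterate_succ_apply']; rfl
  refine ⟨U, F 0, fun x y => ?_, fun k x y => ?_⟩
  · rw [hF, toeplitzMatrix_self]; rfl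
  · have := hpow k.succ x
    rw [Fin.val_succ] at this
    rw [this, hF, toeplitzMatrix_succ_zero]

theorem LinearIsometry.inner_iterate_eigenvector {V : Type*} [NormedAddCommGroup V]
    [InnerProductSpace ℂ V] (U : V →ₗᵢ[ℂ] V) {c : Circle} {b : V} (hb : U b = (c : ℂ) • b)
    (k : ℕ) (x : V) : inner ℂ (U^[k] x) b = ((c⁻¹ : Circle) : ℂ) ^ k * inner ℂ x b := by
  induction k with
  | zero => simp
  | succ k ih =>
    have hc : b = ((c⁻¹ : Circle) : ℂ) • U b := by
      rw [hb, smul_smul, ← Circle.coe_mul]; simp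
    rw [Function.iterate_succ_apply']
    conv_lhs => rw [hc]
    rw [inner_smul_right, U.inner_map_map, ih]
    ring

theorem ToeplitzContractive.exists_sum_smul {n : ℕ} {A : Fin d → Matrix (Fin n) (Fin n) ℂ}
    (hA : ToeplitzContractive (fun k => Matrix.toEuclideanCLM (𝕜 := ℂ) (A k))) :
    ∃ (l : ℕ) (lam : Fin l → Circle) (Q : Fin l → Matrix (Fin n) (Fin n) ℂ),
        (∀ j, (Q j).PosSemidef) ∧ ∑ j, Q j = 1 ∧
          ∀ k : Fin d, A k = ∑ j, (lam j : ℂ) ^ (k.val + 1) • Q j := by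
  obtain ⟨U, F, h1, hk⟩ := hA.exists_dilation
  obtain ⟨b, c, hb⟩ := U.exists_orthonormalBasis_eigenvectors
  let e : Fin n → EuclideanSpace ℂ (Fin n) := fun i => EuclideanSpace.single i 1
  let β : Fin _ → Fin n → ℂ := fun j i => inner ℂ (b j) (F (e i))
  -- `Q j` compresses the projection onto `b j`. The eigenvalues are inverted because `A k`
  -- compresses a power of the adjoint of `U`.
  refine ⟨_, fun j => (c j)⁻¹, fun j => Matrix.vecMulVec (star (β j)) (β j), fun j => ?_, ?_, ?_⟩
  · exact Matrix.posSemidef_vecMulVec_star_self (β j)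
  · ext p q
    have := b.sum_inner_mul_inner (F (e p)) (F (e q))
    rw [h1] at this
    simp only [Matrix.sum_apply, Matrix.vecMulVec_apply, Pi.star_apply, β, RCLike.star_def,
      inner_conj_symm, this]
    simp [e, Matrix.one_apply, EuclideanSpace.inner_single_left]
  · intro k
    ext p q
    have := b.sum_inner_mul_inner (U^[k.val + 1] (F (e p))) (F (e q))
    rw [hk] at this
    simp only [U.inner_iterate_eigenvector (hb _), mul_assoc] at this
    simp only [Matrix.sum_apply, Matrix.smul_apply, Matrix.vecMulVec_apply, Pi.star_apply, β,
      RCLike.star_def, inner_conj_symm, smul_eq_mul, this]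
    simp [e, EuclideanSpace.inner_single_left]

end Toeplitz

/-! ### Unitarity of the bilateral shift -/

section Shift

theorem bilateralShift_surjective : Function.Surjective bilateralShift := by
  intro f
  have h2 : 0 < (2 : ENNReal).toReal := by norm_num
  have hf := (memℓp_gen_iff h2).1 (lp.memℓp f)
  refine ⟨⟨fun i => f (i + 1), (memℓp_gen_iff (E := fun _ : ℤ => ℂ)
    (f := fun i => f (i + 1)) h2).2 (hf.comp_injective (add_left_injective (1 : ℤ)))⟩, ?_⟩
  ext i
  rw [bilateralShift_apply]
  change f (i - 1 + 1) = f i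
  rw [sub_add_cancel]

theorem star_bilateralShift_mul_self : star bilateralShift * bilateralShift = 1 :=
  (ContinuousLinearMap.norm_map_iff_adjoint_comp_self bilateralShift).1
    bilateralShiftIsometry.norm_map

theorem bilateralShift_mul_star_self : bilateralShift * star bilateralShift = 1 := by
  ext1 f
  obtain ⟨g, rfl⟩ := bilateralShift_surjective f
  exact congrArg bilateralShift (DFunLike.congr_fun star_bilateralShift_mul_self g)

theorem bilateralShift_pow_mul_star_pow (i j : ℕ) :
    bilateralShift ^ (i + j) * star (bilateralShift ^ j) = bilateralShift ^ i := by
  have h : bilateralShift ^ j * star (bilateralShift ^ j) = 1 := by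
    have : bilateralShift ∈ unitary _ :=
      Unitary.mem_iff.2 ⟨star_bilateralShift_mul_self, bilateralShift_mul_star_self⟩
    exact (Unitary.mem_iff.1 (pow_mem this j)).2
  rw [pow_add, mul_assoc, h, mul_one]

end Shift

/-! ### From the matrix range to Toeplitz contractivity -/

section Positivity

theorem CStarAlgebra.exists_eq_star_mul_self {B : Type*} [NonUnitalCStarAlgebra B]
    [PartialOrder B] [StarOrderedRing B] {b : B} (hb : 0 ≤ b) : ∃ s, b = star s * s :=
  CStarAlgebra.nonneg_iff_eq_star_mul_self.1 hb

namespace CStarMatrix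

variable {A : Type*} [CStarAlgebra A] [PartialOrder A] [StarOrderedRing A] {k : ℕ}

theorem ofMatrix_mul_star_nonneg (c : Fin (k + 1) → A) :
    0 ≤ CStarMatrix.ofMatrix (fun i j => c i * star (c j)) := by
  -- The column `c`, padded with zeros to a square matrix.
  let C : CStarMatrix (Fin (k + 1)) (Fin (k + 1)) A :=
    CStarMatrix.ofMatrix fun i j => if j = 0 then c i else 0
  have hC : ∀ i j, C i j = if j = 0 then c i else 0 := fun _ _ => rfl
  have : CStarMatrix.ofMatrix (fun i j => c i * star (c j)) = C * star C := by
    ext i j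
    rw [CStarMatrix.mul_apply, Finset.sum_eq_single 0]
    · rw [CStarMatrix.star_apply, hC, hC, if_pos rfl, if_pos rfl]; rfl
    · intro b _ hb; rw [hC, if_neg hb, zero_mul]
    · simp
  rw [this]
  exact mul_star_self_nonneg C

theorem exists_eq_sum_star_mul {M : CStarMatrix (Fin k) (Fin k) A} (hM : 0 ≤ M) :
    ∃ S : Fin k → Fin k → A, ∀ i j, M i j = ∑ l, star (S l i) * S l j := by
  obtain ⟨S, hS⟩ := CStarAlgebra.exists_eq_star_mul_self hM
  refine ⟨fun l i => S l i, fun i j => ?_⟩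
  rw [hS]
  exact CStarMatrix.mul_apply

theorem nonneg_of_eq_sum_star_mul {M : CStarMatrix (Fin k) (Fin k) A} (S : Fin k → Fin k → A)
    (h : ∀ i j, M i j = ∑ l, star (S l i) * S l j) : 0 ≤ M := by
  have : M = star (CStarMatrix.ofMatrix S) * CStarMatrix.ofMatrix S := by
    ext i j
    exact (h i j).trans (CStarMatrix.mul_apply (M := star (CStarMatrix.ofMatrix S))).symm
  rw [this]
  exact star_mul_self_nonneg _

end CStarMatrix

/-- The quadratic form at `x` is `∑ k, ‖∑ j, N k j (x j)‖ ^ 2`. -/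
theorem blockOperator_isPositive_of_eq_sum {H : Type*} [NormedAddCommGroup H]
    [InnerProductSpace ℂ H] [CompleteSpace H] {m : ℕ}
    {M : Matrix (Fin m) (Fin m) (H →L[ℂ] H)} (N : Fin m → Fin m → H →L[ℂ] H)
    (h : ∀ i j, M i j = ∑ k, star (N k i) * N k j) : (blockOperator M).IsPositive := by
  have hin : ∀ i j (x y : H), inner ℂ (M i j x) y = ∑ k, inner ℂ (N k j x) (N k i y) :=
    fun i j x y => by
      rw [h, sum_apply, sum_inner]
      exact Finset.sum_congr rfl fun k _ => ContinuousLinearMap.adjoint_inner_left (N k i) _ _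
  have key : ∀ x, inner ℂ (blockOperator M x) x =
      ((∑ k, ‖∑ j, N k j (x j)‖ ^ 2 : ℝ) : ℂ) := fun x => by
    rw [inner_blockOperator, Complex.ofReal_sum]
    have : ∀ k, ((‖∑ j, N k j (x j)‖ ^ 2 : ℝ) : ℂ) =
        ∑ i, ∑ j, inner ℂ (N k j (x j)) (N k i (x i)) := fun k => by
      rw [Complex.ofReal_pow]
      refine (inner_self_eq_norm_sq_to_K (𝕜 := ℂ) (∑ j, N k j (x j))).symm.trans ?_
      rw [inner_sum]
      simp_rw [sum_inner]
    simp only [this, hin]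
    rw [Finset.sum_comm]
    refine (Finset.sum_congr rfl fun j _ => Finset.sum_comm).trans ?_
    rw [Finset.sum_comm]
    exact Finset.sum_congr rfl fun k _ => Finset.sum_comm
  rw [ContinuousLinearMap.isPositive_iff_complex]
  intro x
  rw [key, RCLike.re_to_complex, Complex.ofReal_re]
  exact ⟨rfl, by positivity⟩

theorem toeplitzContractive_of_mem_nthMatrixRange {d n : ℕ}
    {A : Fin d → Matrix (Fin n) (Fin n) ℂ} (hA : A ∈ nthMatrixRange (shiftPowers d) n) :
    ToeplitzContractive (fun k => Matrix.toEuclideanCLM (𝕜 := ℂ) (A k)) := by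
  obtain ⟨φ, h1, hφ⟩ := hA
  let c : Fin (d + 1) → EllTwoInt →L[ℂ] EllTwoInt := fun i => bilateralShift ^ i.val
  obtain ⟨S, hS⟩ := CStarMatrix.exists_eq_sum_star_mul
    (φ.map_cstarMatrix_nonneg' _ _ (CStarMatrix.ofMatrix_mul_star_nonneg c))
  have hent : ∀ i j, φ (c i * star (c j)) = ∑ k, star (S k i) * S k j := hS
  have hlow : ∀ (i j : Fin (d + 1)) (h : j < i),
      φ (c i * star (c j)) = CStarMatrix.ofMatrix (A ⟨i - j - 1, by omega⟩) := fun i j h => by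
    have hij : i.val = i.val - j.val - 1 + 1 + j.val := by
      have : j.val < i.val := h
      omega
    have : c i * star (c j) = shiftPowers d ⟨i - j - 1, by omega⟩ := by
      refine Eq.trans ?_ (bilateralShift_pow_mul_star_pow (i.val - j.val - 1 + 1) j)
      rw [← hij]
    rw [this, hφ]
  let E : CStarMatrix (Fin n) (Fin n) ℂ →
      (EuclideanSpace ℂ (Fin n) →L[ℂ] EuclideanSpace ℂ (Fin n)) :=
    fun X => Matrix.toEuclideanCLM (𝕜 := ℂ) (CStarMatrix.ofMatrix.symm X)
  have hEstar : ∀ X, E (star X) = star (E X) := fun X =>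
    map_star (Matrix.toEuclideanCLM (𝕜 := ℂ)) (CStarMatrix.ofMatrix.symm X)
  have hEmul : ∀ X Y, E (X * Y) = E X * E Y := fun X Y =>
    map_mul (Matrix.toEuclideanCLM (𝕜 := ℂ)) (CStarMatrix.ofMatrix.symm X)
      (CStarMatrix.ofMatrix.symm Y)
  have hEsum : ∀ f : Fin (d + 1) → CStarMatrix (Fin n) (Fin n) ℂ,
      E (∑ k, f k) = ∑ k, E (f k) := fun f =>
    map_sum (Matrix.toEuclideanCLM (𝕜 := ℂ) (n := Fin n)) f Finset.univ
  have hE : ∀ i j, toeplitzMatrix (fun k => Matrix.toEuclideanCLM (𝕜 := ℂ) (A k)) i j =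
      E (φ (c i * star (c j))) := fun i j => by
    rcases lt_trichotomy i j with h | rfl | h
    -- The Gram factorization of the image already shows that it is Hermitian.
    · have : φ (c i * star (c j)) = star (φ (c j * star (c i))) := by
        rw [hent, hent, star_sum]
        exact Finset.sum_congr rfl fun k _ => by rw [star_mul, star_star]
      rw [this, hlow j i h, toeplitzMatrix, dif_neg h.not_gt, dif_pos h, hEstar]
      rfl
    · have : c i * star (c i) = 1 := by
        have := bilateralShift_pow_mul_star_pow 0 i
        rwa [zero_add, pow_zero] at this
      rw [toeplitzMatrix_self, this, h1]
      exact (map_one (Matrix.toEuclideanCLM (𝕜 := ℂ))).symm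
    · rw [hlow i j h, toeplitzMatrix, dif_pos h]
      rfl
  refine blockOperator_isPositive_of_eq_sum (fun k j => E (S k j)) fun i j => ?_
  rw [hE, hent, hEsum]
  exact Finset.sum_congr rfl fun k _ => by rw [hEmul, hEstar]

end Positivity

/-! ### States from approximate eigenvectors -/

section States

open Filter Topology

variable {H : Type*} [NormedAddCommGroup H] [InnerProductSpace ℂ H]

/-- The vector states of a sequence of unit vectors have a limit along an ultrafilter. -/
theorem exists_linearMap_tendsto_inner (v : ℕ → H) (hv : ∀ N, ‖v N‖ = 1) :
    ∃ s : (H →L[ℂ] H) →ₗ[ℂ] ℂ,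
      ∀ T, Tendsto (fun N => inner ℂ (v N) (T (v N))) (hyperfilter ℕ) (𝓝 (s T)) := by
  have hlim : ∀ T : H →L[ℂ] H, ∃ c,
      Tendsto (fun N => inner ℂ (v N) (T (v N))) (hyperfilter ℕ) (𝓝 c) := fun T => by
    obtain ⟨c, -, hc⟩ := (isCompact_closedBall (0 : ℂ) ‖T‖).ultrafilter_le_nhds
      ((hyperfilter ℕ).map fun N => inner ℂ (v N) (T (v N))) (by
        rw [Ultrafilter.coe_map, le_principal_iff, mem_map]
        refine univ_mem' fun N => mem_closedBall_zero_iff.2 ?_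
        refine (norm_inner_le_norm _ _).trans ?_
        rw [hv, one_mul]
        exact T.unit_le_opNorm _ (hv N).le)
    exact ⟨c, hc⟩
  choose s hs using hlim
  refine ⟨{ toFun := s, map_add' := fun T T' => ?_, map_smul' := fun c T => ?_ }, hs⟩
  · refine tendsto_nhds_unique (hs _) (((hs T).add (hs T')).congr fun N => ?_)
    rw [add_apply, inner_add_right]
  · refine tendsto_nhds_unique (hs _) (((hs T).const_mul c).congr fun N => ?_)
    rw [smul_apply, inner_smul_right]

theorem tendsto_pow_apply_sub_smul (W : H →L[ℂ] H) (c : ℂ) (v : ℕ → H)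
    (h : Tendsto (fun N => W (v N) - c • v N) atTop (𝓝 0)) (k : ℕ) :
    Tendsto (fun N => (W ^ k) (v N) - c ^ k • v N) atTop (𝓝 0) := by
  induction k with
  | zero => simp
  | succ k ih =>
    have := ((W.continuous.tendsto 0).comp ih).add (h.const_smul (c ^ k))
    rw [map_zero, smul_zero, add_zero] at this
    refine this.congr fun N => ?_
    simp only [Function.comp_apply, map_sub, map_smul, pow_succ' W, smul_sub, smul_smul, ← pow_succ]
    exact sub_add_sub_cancel _ _ _

/-- An approximate eigenvalue of `W` is attained by a state that is multiplicative on the powers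
of `W`. -/
theorem exists_state_of_approximate_eigenvectors [CompleteSpace H] (W : H →L[ℂ] H) (c : ℂ)
    (v : ℕ → H) (hv : ∀ N, ‖v N‖ = 1)
    (h : Tendsto (fun N => W (v N) - c • v N) atTop (𝓝 0)) :
    ∃ s : (H →L[ℂ] H) →ₗ[ℂ] ℂ, (∀ k : ℕ, s (W ^ k) = c ^ k) ∧
      (∀ T, 0 ≤ s (star T * T)) := by
  obtain ⟨s, hs⟩ := exists_linearMap_tendsto_inner v hv
  have hle : (hyperfilter ℕ : Filter ℕ) ≤ atTop := Nat.hyperfilter_le_atTop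
  refine ⟨s, fun k => tendsto_nhds_unique (hs _) ?_, fun T => ?_⟩
  · have h1 : Tendsto (fun N => inner ℂ (v N) ((W ^ k) (v N) - c ^ k • v N))
        (hyperfilter ℕ) (𝓝 0) := by
      rw [tendsto_zero_iff_norm_tendsto_zero]
      refine squeeze_zero (fun _ => norm_nonneg _) (fun N => ?_)
        ((tendsto_zero_iff_norm_tendsto_zero.1 (tendsto_pow_apply_sub_smul W c v h k)).mono_left hle)
      exact (norm_inner_le_norm _ _).trans (by rw [hv, one_mul])
    have h2 := h1.add_const (c ^ k)
    rw [zero_add] at h2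
    refine h2.congr fun N => ?_
    rw [inner_sub_right, inner_smul_right, inner_self_eq_norm_sq_to_K, hv]
    simp
  · refine ge_of_tendsto' (hs _) fun N => ?_
    have : inner ℂ (v N) ((star T * T) (v N)) = inner ℂ (T (v N)) (T (v N)) :=
      ContinuousLinearMap.adjoint_inner_right T _ _
    rw [this]
    rw [inner_self_eq_norm_sq_to_K]
    have h0 := Complex.zero_le_real.2 (sq_nonneg ‖T (v N)‖)
    rw [Complex.ofReal_pow] at h0
    exact h0

theorem bilateralShift_single (i : ℤ) (a : ℂ) :
    bilateralShift (lp.single 2 i a) = lp.single 2 (i + 1) a := by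
  ext j
  rw [bilateralShift_apply, lp.single_apply, lp.single_apply, Pi.single_apply, Pi.single_apply]
  simp only [sub_eq_iff_eq_add]

/-- Truncate the formal eigenvector `∑ c⁻ⁱ eᵢ`: applying `W - c` telescopes to two boundary terms of
total norm at most 2, while the truncation has norm `√(N + 1)`. -/
theorem exists_approximate_eigenvectors_bilateralShift (c : Circle) :
    ∃ v : ℕ → EllTwoInt, (∀ N, ‖v N‖ = 1) ∧
      Tendsto (fun N => bilateralShift (v N) - (c : ℂ) • v N) atTop (𝓝 0) := by
  let g : ℕ → EllTwoInt := fun i => lp.single 2 (i : ℤ) (((c⁻¹ ^ i : Circle)) : ℂ)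
  have hg : ∀ i, ‖g i‖ = 1 := fun i => by
    rw [lp.norm_single (by norm_num), Circle.norm_coe]
  have hW : ∀ i, bilateralShift (g i) = (c : ℂ) • g (i + 1) := fun i => by
    rw [bilateralShift_single, ← lp.single_smul, smul_eq_mul, ← Circle.coe_mul, pow_succ',
      mul_inv_cancel_left]
    rfl
  let u : ℕ → EllTwoInt := fun N => ∑ i ∈ Finset.range (N + 1), g i
  have hu : ∀ N, ‖u N‖ ^ 2 = N + 1 := fun N => by
    have hin : ∀ i j, inner ℂ (g i) (g j) = if i = j then 1 else 0 := fun i j => by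
      split_ifs with h
      · rw [h, inner_self_eq_norm_sq_to_K, hg]; simp
      · rw [lp.inner_single_left, lp.single_apply_ne _ _ _ (by exact_mod_cast h), inner_zero_right]
    have : inner ℂ (u N) (u N) = ((N : ℂ) + 1) := by
      simp only [u, sum_inner, inner_sum, hin]
      refine (Finset.sum_congr rfl fun i hi => ?_).trans (b := ∑ i ∈ Finset.range (N + 1), 1) ?_
      · rw [Finset.sum_ite_eq', if_pos hi]
      · simp
    rw [inner_self_eq_norm_sq_to_K] at this
    rw [← Complex.ofReal_inj]
    push_cast
    exact this
  have hu0 : ∀ N, 0 < ‖u N‖ := fun N => by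
    refine (norm_nonneg _).lt_of_ne fun h => ?_
    have := hu N
    rw [← h] at this
    have hN : (0 : ℝ) ≤ N := N.cast_nonneg
    linarith
  have hWu : ∀ N, bilateralShift (u N) - (c : ℂ) • u N = (c : ℂ) • (g (N + 1) - g 0) := fun N => by
    simp only [u]
    rw [map_sum, ← Finset.sum_range_sub, Finset.smul_sum, Finset.smul_sum,
      ← Finset.sum_sub_distrib]
    exact Finset.sum_congr rfl fun i _ => by rw [hW, smul_sub]
  refine ⟨fun N => ((‖u N‖⁻¹ : ℝ) : ℂ) • u N, fun N => ?_, ?_⟩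
  · rw [norm_smul, Complex.norm_real, norm_inv, norm_norm, inv_mul_cancel₀ (hu0 N).ne']
  · have hlim : Tendsto (fun N => ‖u N‖⁻¹ * 2) atTop (𝓝 0) := by
      rw [← zero_mul (2 : ℝ)]
      refine Tendsto.mul_const _ (tendsto_inv_atTop_zero.comp ?_)
      have : (fun N => ‖u N‖) = fun N : ℕ => √((N : ℝ) + 1) := by
        ext N; rw [← hu, Real.sqrt_sq (norm_nonneg _)]
      rw [this]
      exact Real.tendsto_sqrt_atTop.comp
        (tendsto_atTop_add_const_right _ _ tendsto_natCast_atTop_atTop)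
    rw [tendsto_zero_iff_norm_tendsto_zero]
    refine squeeze_zero (fun _ => norm_nonneg _) (fun N => ?_) hlim
    rw [map_smul, smul_comm (c : ℂ), ← smul_sub, hWu, norm_smul, norm_smul, Circle.norm_coe,
      one_mul, Complex.norm_real, norm_inv, norm_norm]
    gcongr
    refine (norm_sub_le _ _).trans ?_
    rw [hg, hg]
    norm_num

end States

/-! ### Completely positive maps from states and weights -/

section CompletePositivity

/-- The quadratic form at `x` is `∑ l, s (star y_l * y_l)` with `y_l = ∑ i, x i • S l i`. -/
theorem posSemidef_of_map_gram {A : Type*} [Ring A] [StarRing A] [Algebra ℂ A] [StarModule ℂ A]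
    (s : A →ₗ[ℂ] ℂ) (hs : ∀ a, 0 ≤ s (star a * a)) {k : ℕ} (S : Fin k → Fin k → A) :
    (Matrix.of fun i j => s (∑ l, star (S l i) * S l j)).PosSemidef := by
  rw [← Matrix.isPositive_toEuclideanLin_iff, LinearMap.isPositive_iff_complex]
  intro x
  have key : inner ℂ x (Matrix.toEuclideanLin
      (Matrix.of fun i j => s (∑ l, star (S l i) * S l j)) x) =
      ∑ l, s (star (∑ i, x i • S l i) * ∑ j, x j • S l j) := by
    simp only [PiLp.inner_apply, Matrix.toLpLin_apply, Matrix.mulVec, dotProduct,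
      Matrix.of_apply, RCLike.inner_apply, star_sum, star_smul, Finset.sum_mul, Finset.mul_sum,
      smul_mul_smul_comm, map_sum, map_smul, smul_eq_mul]
    refine (Finset.sum_congr rfl fun i _ => Finset.sum_comm).trans (Finset.sum_comm.trans ?_)
    refine Finset.sum_congr rfl fun l _ => Finset.sum_comm.trans ?_
    refine Finset.sum_congr rfl fun j _ => Finset.sum_congr rfl fun i _ => ?_
    rw [RCLike.star_def]
    ring
  have hpos := Complex.nonneg_iff.1 (Finset.sum_nonneg fun l (_ : l ∈ Finset.univ) =>
    hs (∑ i, x i • S l i))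
  rw [← key, ← inner_conj_symm] at hpos
  simp only [Complex.conj_re, Complex.conj_im] at hpos
  have hpos' := hpos.2
  rw [zero_eq_neg] at hpos'
  exact ⟨Complex.ext rfl hpos'.symm, hpos.1⟩

open scoped MatrixOrder in
theorem Matrix.PosSemidef.exists_eq_conjTranspose_mul_self {ι : Type*} [Fintype ι] [DecidableEq ι]
    {Q : Matrix ι ι ℂ} (hQ : Q.PosSemidef) : ∃ P : Matrix ι ι ℂ, Q = P.conjTranspose * P :=
  CStarAlgebra.nonneg_iff_eq_star_mul_self.1 hQ.nonneg

/-- The completely positive map `a ↦ ∑ j, s j a • Q j` given by positive functionals `s j` and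
positive semidefinite matrices `Q j`. -/
theorem exists_completelyPositiveMap {A : Type*} [CStarAlgebra A] [PartialOrder A]
    [StarOrderedRing A] {n l : ℕ} (s : Fin l → A →ₗ[ℂ] ℂ) (hs : ∀ j a, 0 ≤ s j (star a * a))
    (Q : Fin l → Matrix (Fin n) (Fin n) ℂ) (hQ : ∀ j, (Q j).PosSemidef) :
    ∃ φ : A →CP CStarMatrix (Fin n) (Fin n) ℂ,
      ∀ a, φ a = CStarMatrix.ofMatrix (∑ j, s j a • Q j) := by
  let ψ : Fin l → A →ₗ[ℂ] CStarMatrix (Fin n) (Fin n) ℂ := fun j =>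
    (s j).smulRight (CStarMatrix.ofMatrix (Q j))
  refine ⟨{ ∑ j, ψ j with map_cstarMatrix_nonneg' := fun k M hM => ?_ }, fun a => ?_⟩
  · have hsum : M.map (∑ j, ψ j : A →ₗ[ℂ] CStarMatrix (Fin n) (Fin n) ℂ) = ∑ j, M.map (ψ j) := by
      ext1 a b
      refine (LinearMap.sum_apply _ _ _).trans (Eq.symm ?_)
      exact (congrFun (Finset.sum_apply a Finset.univ fun j => (M.map (ψ j))) b).trans
        (Finset.sum_apply b Finset.univ fun j => (M.map (ψ j)) a)
    refine le_of_le_of_eq (Finset.sum_nonneg fun j _ => ?_) hsum.symm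
    -- If `s j` sends `M` entrywise to `R* R` and `Q j = P* P`, the image is `(R ⊗ P)* (R ⊗ P)`.
    obtain ⟨S, hS⟩ := CStarMatrix.exists_eq_sum_star_mul hM
    obtain ⟨P, hP⟩ := (hQ j).exists_eq_conjTranspose_mul_self
    obtain ⟨R, hR⟩ := (posSemidef_of_map_gram (s j) (hs j) S).exists_eq_conjTranspose_mul_self
    refine CStarMatrix.nonneg_of_eq_sum_star_mul
      (fun a b => CStarMatrix.ofMatrix (R a b • P)) fun a b => ?_
    have hsR : s j (M a b) = ∑ c, star (R c a) * R c b := by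
      rw [hS]
      exact congrFun (congrFun hR a) b
    have : s j (M a b) • Q j = ∑ c, (R c a • P).conjTranspose * (R c b • P) := by
      rw [hsR, hP, Finset.sum_smul]
      refine Finset.sum_congr rfl fun c _ => ?_
      rw [Matrix.conjTranspose_smul, smul_mul_smul_comm]
    exact this
  · exact LinearMap.sum_apply _ _ _

end CompletePositivity

/-! ### Closing the cycle -/

theorem mem_nthMatrixRange_shiftPowers_of_eq_sum {d n l : ℕ}
    {A : Fin d → Matrix (Fin n) (Fin n) ℂ} (lam : Fin l → Circle)
    (Q : Fin l → Matrix (Fin n) (Fin n) ℂ) (hQ : ∀ j, (Q j).PosSemidef) (h1 : ∑ j, Q j = 1)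
    (hA : ∀ k : Fin d, A k = ∑ j, (lam j : ℂ) ^ (k.val + 1) • Q j) :
    A ∈ nthMatrixRange (shiftPowers d) n := by
  have hst : ∀ j, ∃ s : (EllTwoInt →L[ℂ] EllTwoInt) →ₗ[ℂ] ℂ,
      (∀ k : ℕ, s (bilateralShift ^ k) = (lam j : ℂ) ^ k) ∧ ∀ T, 0 ≤ s (star T * T) := fun j => by
    obtain ⟨v, hv, hlim⟩ := exists_approximate_eigenvectors_bilateralShift (lam j)
    exact exists_state_of_approximate_eigenvectors bilateralShift (lam j) v hv hlim
  choose s hs hs0 using hst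
  obtain ⟨φ, hφ⟩ := exists_completelyPositiveMap s hs0 Q hQ
  have hpow : ∀ k : ℕ, φ (bilateralShift ^ k) =
      CStarMatrix.ofMatrix (∑ j, (lam j : ℂ) ^ k • Q j) := fun k => by
    rw [hφ]
    simp only [hs]
  refine ⟨φ, ?_, fun k => ?_⟩
  -- Unitality is the zeroth power, where the weights sum to the identity.
  · have := hpow 0
    simp only [pow_zero, one_smul, h1] at this
    exact this
  · rw [hA]
    exact hpow (k.val + 1)

theorem theorem5 (d n : ℕ) (A : Fin d → Matrix (Fin n) (Fin n) ℂ) :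
    List.TFAE [
      (⟨n, A⟩ : Σ n : ℕ, Fin d → Matrix (Fin n) (Fin n) ℂ) ∈ matrixRange (shiftPowers d),
      ToeplitzContractive (fun k => Matrix.toEuclideanCLM (𝕜 := ℂ) (A k)),
      ∃ (l : ℕ) (lam : Fin l → Circle) (Q : Fin l → Matrix (Fin n) (Fin n) ℂ),
        (∀ j, (Q j).PosSemidef) ∧ ∑ j, Q j = 1 ∧
          ∀ k : Fin d, A k = ∑ j, (lam j : ℂ) ^ (k.val + 1) • Q j] := by
  tfae_have 1 → 2 := toeplitzContractive_of_mem_nthMatrixRange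
  tfae_have 2 → 3 := ToeplitzContractive.exists_sum_smul
  tfae_have 3 → 1 := fun ⟨_, lam, Q, hQ, h1, hA⟩ =>
    mem_nthMatrixRange_shiftPowers_of_eq_sum lam Q hQ h1 hA
  tfae_finish
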